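/- \textbf{Setting.} Let $(M^{2n+1},g)$ be a smooth Riemannian manifold with a contact metric structure $(\varphi,\xi,\eta)$: a smooth $(1,1)$-tensor field $\varphi$, a smooth vector field $\xi$ and a smooth $1$-form $\eta$ with $$\varphi^2=-I+\eta\otimes\xi,\qquad \eta(\xi)=1,\qquad g(\varphi X,\varphi Y)=g(X,Y)-\eta(X)\eta(Y),\qquad d\eta(X,Y)=g(X,\varphi Y),$$ where $d\eta(X,Y)=\tfrac12\bigl(X\eta(Y)-Y\eta(X)-\eta([X,Y])\bigr)$. Put $h=\tfrac12 L_\xi\varphi$, that is, $hX=\tfrac12([\xi,\varphi X]-\varphi[\xi,X])$. Assume that $M$ is a $(\kappa,\mu)$-space: for some real constants $\kappa,\mu$ and all vector fields $X,Y$, $$R(X,Y)\xi=\kappa\,(\eta(Y)X-\eta(X)Y)+\mu\,(\eta(Y)hX-\eta(X)hY),$$ where $R(X,Y)Z=\nabla_X\nabla_YZ-\nabla_Y\nabla_XZ-\nabla_{[X,Y]}Z$ and $\nabla$ is the Levi-Civita connection of $g$. Let $N$ be an immersed Legendrian submanifold of $M$, that is, an immersed submanifold of dimension $n$ to which $\xi$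 is normal, with the induced metric. \textbf{Proposition.} For every $p\in N$ and every $X\in T_pN$ there are unique vectors $h_1X,h_2X\in T_pN$ such that $$hX=h_1X+\varphi h_2X,$$ where $h_1X$ is the tangent component and $\varphi h_2X$ the normal component of $hX$. The resulting maps $h_1,h_2:T_pN\to T_pN$ are linear and symmetric with respect to the induced metric, and satisfy $$h_1^2+h_2^2=(1-\kappa)I,\qquad h_1h_2=h_2h_1 .$$ Moreover $h_1\xi=h_2\xi=0$ along $N$, in the sense that $u=w=0$ are the unique $u,w\in T_pN$ such that $h\xi=u+\varphi w$ with $\varphi w$ normal to $N$. -/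

import Mathlib

open Bundle VectorField
open scoped Manifold ContDiff

namespace KappaMu

section Riemannian

variable {E : Type*} [NormedAddCommGroup E] [NormedSpace ℝ E] [FiniteDimensional ℝ E]
  {H : Type*} [TopologicalSpace H] {I : ModelWithCorners ℝ E H}
  {M : Type*} [TopologicalSpace M] [ChartedSpace H M]

/-- The vector field `X` is smooth near the point `x`. -/
def SmoothFieldAt [IsManifold I ∞ M] (X : Π x : M, TangentSpace I x) (x : M) : Prop :=
  CMDiffAt ∞ (T% X) x

/-- The exterior derivative of a one-form `η`, evaluated on two vector fields, with the
normalisation `2 dη(X, Y) = X(η(Y)) - Y(η(X)) - η([X, Y])` customary in contact metric geometry. -/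
noncomputable def dOneForm (η : Π x : M, TangentSpace I x →L[ℝ] ℝ)
    (X Y : Π x : M, TangentSpace I x) (x : M) : ℝ :=
  (1 / 2) * (mvfderiv I (fun y ↦ η y (Y y)) x (X x) - mvfderiv I (fun y ↦ η y (X y)) x (Y x)
    - η x (mlieBracket I X Y x))

/-- The Lie derivative `(L_ξ φ) X = [ξ, φ X] - φ [ξ, X]` of a `(1,1)`-tensor field `φ`. -/
noncomputable def lieDerivFun (φ : Π x : M, TangentSpace I x →L[ℝ] TangentSpace I x)
    (ξ X : Π x : M, TangentSpace I x) (x : M) : TangentSpace I x :=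
  mlieBracket I ξ (fun y ↦ φ y (X y)) x - φ x (mlieBracket I ξ X x)

variable [IsManifold I ∞ M]

theorem mdifferentiableAt_apply
    {φ : Π x : M, TangentSpace I x →L[ℝ] TangentSpace I x}
    (hφ : ContMDiff I (I.prod 𝓘(ℝ, E →L[ℝ] E)) ∞
      (fun x ↦ TotalSpace.mk' (E →L[ℝ] E)
        (E := fun x : M ↦ TangentSpace I x →L[ℝ] TangentSpace I x) x (φ x)))
    {X : Π x : M, TangentSpace I x} {x : M} (hX : MDiffAt (T% X) x) :
    MDiffAt (T% (fun y ↦ φ y (X y))) x :=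
  MDifferentiableAt.clm_bundle_apply
    (hφ.mdifferentiable (by simp) x) hX

/-- `L_ξ φ` is tensorial. -/
theorem lieDerivFun_tensorial
    {φ : Π x : M, TangentSpace I x →L[ℝ] TangentSpace I x}
    (hφ : ContMDiff I (I.prod 𝓘(ℝ, E →L[ℝ] E)) ∞
      (fun x ↦ TotalSpace.mk' (E →L[ℝ] E)
        (E := fun x : M ↦ TangentSpace I x →L[ℝ] TangentSpace I x) x (φ x)))
    (ξ : Π x : M, TangentSpace I x) (x : M) :
    TensorialAt I E (lieDerivFun φ ξ · x) x where
  smul {f X} hf hX := by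
    have h1 : (fun y ↦ φ y ((f • X) y)) = f • (fun y ↦ φ y (X y)) := by
      funext y; simp
    simp only [lieDerivFun, h1]
    rw [mlieBracket_smul_right hf (mdifferentiableAt_apply hφ hX), mlieBracket_smul_right hf hX]
    simp only [map_add, map_smul]
    module
  add {X Y} hX hY := by
    have h1 : (fun y ↦ φ y ((X + Y) y)) = (fun y ↦ φ y (X y)) + (fun y ↦ φ y (Y y)) := by
      funext y; simp
    simp only [lieDerivFun, h1]
    rw [mlieBracket_add_right (mdifferentiableAt_apply hφ hX) (mdifferentiableAt_apply hφ hY),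
      mlieBracket_add_right hX hY]
    simp only [map_add]
    module

/-- The curvature `R(X, Y)Z = ∇_X ∇_Y Z - ∇_Y ∇_X Z - ∇_[X, Y] Z`
(in Mathlib `∇ Z x (X x)` stands for `(∇_X Z)(x)`). -/
noncomputable def curvature (cov : CovariantDerivative I E (fun x : M ↦ TangentSpace I x))
    (X Y Z : Π x : M, TangentSpace I x) (x : M) : TangentSpace I x :=
  cov (fun y ↦ cov Z y (Y y)) x (X x) - cov (fun y ↦ cov Z y (X y)) x (Y x)
    - cov Z x (mlieBracket I X Y x)

variable [RiemannianBundle (fun x : M ↦ TangentSpace I x)]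
  [IsContMDiffRiemannianBundle I ∞ E (fun x : M ↦ TangentSpace I x)]

/-- `cov` is the Levi-Civita connection: metric and torsion free. These two properties determine
`cov` on all differentiable vector fields. -/
def IsLeviCivita (cov : CovariantDerivative I E (fun x : M ↦ TangentSpace I x)) : Prop :=
  (∀ (x : M) (v : TangentSpace I x) (X Y : Π x : M, TangentSpace I x),
    MDiffAt (T% X) x → MDiffAt (T% Y) x →
      mvfderiv I (fun y ↦ (inner ℝ (X y) (Y y) : ℝ)) x v =
        inner ℝ (cov X x v) (Y x) + inner ℝ (X x) (cov Y x v)) ∧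
    cov.torsion = 0

variable (I M) in
/-- A contact metric structure `(φ, ξ, η)` on the Riemannian manifold `M`. -/
structure ContactMetricStructure where
  /-- The structure tensor of type `(1,1)`. -/
  φ : Π x : M, TangentSpace I x →L[ℝ] TangentSpace I x
  /-- The characteristic vector field. -/
  ξ : Π x : M, TangentSpace I x
  /-- The contact form. -/
  η : Π x : M, TangentSpace I x →L[ℝ] ℝ
  smooth_φ : ContMDiff I (I.prod 𝓘(ℝ, E →L[ℝ] E)) ∞
    (fun x ↦ TotalSpace.mk' (E →L[ℝ] E)
      (E := fun x : M ↦ TangentSpace I x →L[ℝ] TangentSpace I x) x (φ x))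
  smooth_ξ : CMDiff ∞ (T% ξ)
  smooth_η : ContMDiff I (I.prod 𝓘(ℝ, E →L[ℝ] ℝ)) ∞
    (fun x ↦ TotalSpace.mk' (E →L[ℝ] ℝ)
      (E := fun x : M ↦ TangentSpace I x →L[ℝ] Bundle.Trivial M ℝ x) x (η x))
  φ_sq : ∀ (x : M) (v : TangentSpace I x), φ x (φ x v) = -v + η x v • ξ x
  η_ξ : ∀ x : M, η x (ξ x) = 1
  compatible : ∀ (x : M) (v w : TangentSpace I x),
    inner ℝ (φ x v) (φ x w) = inner ℝ v w - η x v * η x w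
  contact : ∀ (x : M) (X Y : Π x : M, TangentSpace I x),
    SmoothFieldAt X x → SmoothFieldAt Y x →
      dOneForm η X Y x = inner ℝ (X x) (φ x (Y x))

namespace ContactMetricStructure

variable (S : ContactMetricStructure I M)

/-- The tensor field `h = (1/2) L_ξ φ`. -/
noncomputable def h (x : M) : TangentSpace I x →L[ℝ] TangentSpace I x :=
  (1 / 2 : ℝ) • TensorialAt.mkHom (lieDerivFun S.φ S.ξ · x) x
    (lieDerivFun_tensorial S.smooth_φ S.ξ x)

/-- On vector fields, `h X = (1/2) ([ξ, φ X] - φ [ξ, X])`. -/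
theorem h_apply {X : Π x : M, TangentSpace I x} {x : M} (hX : MDiffAt (T% X) x) :
    S.h x (X x) = (1 / 2 : ℝ) •
      (mlieBracket I S.ξ (fun y ↦ S.φ y (X y)) x - S.φ x (mlieBracket I S.ξ X x)) := by
  simp only [h, smul_apply]
  rw [TensorialAt.mkHom_apply (lieDerivFun_tensorial S.smooth_φ S.ξ x) hX]
  rfl

/-- The contact metric manifold is a `(κ, μ)`-space:
`R(X, Y)ξ = κ (η(Y)X - η(X)Y) + μ (η(Y)hX - η(X)hY)`, with `R` the curvature of the
Levi-Civita connection. -/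
def IsKappaMuSpace (κ μ : ℝ) : Prop :=
  ∃ cov : CovariantDerivative I E (fun x : M ↦ TangentSpace I x), IsLeviCivita cov ∧
    ∀ (x : M) (X Y : Π x : M, TangentSpace I x), SmoothFieldAt X x → SmoothFieldAt Y x →
      curvature cov X Y S.ξ x =
        κ • (S.η x (Y x) • X x - S.η x (X x) • Y x) +
        μ • (S.η x (Y x) • S.h x (X x) - S.η x (X x) • S.h x (Y x))

end ContactMetricStructure

end Riemannian

section Legendrian

variable {n : ℕ}
  {M : Type*} [TopologicalSpace M] [ChartedSpace (EuclideanSpace ℝ (Fin (2 * n + 1))) M]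
  [IsManifold (𝓡 (2 * n + 1)) ∞ M]
  [RiemannianBundle (fun x : M ↦ TangentSpace (𝓡 (2 * n + 1)) x)]
  [IsContMDiffRiemannianBundle (𝓡 (2 * n + 1)) ∞ (EuclideanSpace ℝ (Fin (2 * n + 1)))
    (fun x : M ↦ TangentSpace (𝓡 (2 * n + 1)) x)]
  {N : Type*} [TopologicalSpace N] [ChartedSpace (EuclideanSpace ℝ (Fin n)) N]

/-- The differential of `f : N → M` at `p`. -/
noncomputable abbrev df (f : N → M) (p : N) :
    TangentSpace (𝓡 n) p →L[ℝ] TangentSpace (𝓡 (2 * n + 1)) (f p) :=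
  mfderiv (𝓡 n) (𝓡 (2 * n + 1)) f p

/-- `f` immerses the `n`-dimensional manifold `N` as a Legendrian submanifold of the
`(2n+1)`-dimensional contact metric manifold `M`: it is a smooth immersion and `ξ` is normal. -/
structure IsLegendrian (S : ContactMetricStructure (𝓡 (2 * n + 1)) M) (f : N → M) : Prop where
  smooth : ContMDiff (𝓡 n) (𝓡 (2 * n + 1)) ∞ f
  immersion : ∀ p : N, Function.Injective (df (n := n) f p)
  normal : ∀ (p : N) (X : TangentSpace (𝓡 n) p), inner ℝ (S.ξ (f p)) (df (n := n) f p X) = 0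

/-- For a vector `V` of `M` at `f p` and tangent vectors `u`, `w` of `N` at `p`:
`h V = u + φ w`, where `u` is the tangent and `φ w` the normal component of `h V`. -/
def IsSplitting (S : ContactMetricStructure (𝓡 (2 * n + 1)) M) (f : N → M) (p : N)
    (V : TangentSpace (𝓡 (2 * n + 1)) (f p)) (u w : TangentSpace (𝓡 n) p) : Prop :=
  S.h (f p) V = df (n := n) f p u + S.φ (f p) (df (n := n) f p w) ∧
    ∀ Z : TangentSpace (𝓡 n) p, inner ℝ (S.φ (f p) (df (n := n) f p w)) (df (n := n) f p Z) = 0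

end Legendrian

end KappaMu

namespace KappaMu

set_option linter.unusedSectionVars false

section Fields

open Filter Topology

variable {E : Type*} [NormedAddCommGroup E] [NormedSpace ℝ E]
  {H : Type*} [TopologicalSpace H] {I : ModelWithCorners ℝ E H}
  {M : Type*} [TopologicalSpace M] [ChartedSpace H M] [IsManifold I ∞ M]

theorem mvfderiv_congr_of_eventuallyEq {I : ModelWithCorners ℝ E H} {M : Type*}
    [TopologicalSpace M] [ChartedSpace H M] {f g : M → ℝ} {x : M} (h : f =ᶠ[𝓝 x] g) :
    mvfderiv I f x = mvfderiv I g x := by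
  ext v
  exact congrArg (fun L : TangentSpace I x →L[ℝ] ℝ ↦ L v) h.mfderiv_eq

/-- The vector field `X` is smooth at all points near `x`. -/
def SmoothNear (X : Π x : M, TangentSpace I x) (x : M) : Prop :=
  ∀ᶠ y in 𝓝 x, SmoothFieldAt X y

variable {X Y : Π x : M, TangentSpace I x} {f : M → ℝ} {x : M}

theorem SmoothNear.self (hX : SmoothNear X x) : CMDiffAt ∞ (T% X) x := hX.self_of_nhds

theorem SmoothNear.mdifferentiableAt (hX : SmoothNear X x) : MDiffAt (T% X) x :=
  hX.self.mdifferentiableAt (by simp)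

theorem SmoothNear.eventually (hX : SmoothNear X x) : ∀ᶠ y in 𝓝 x, SmoothNear X y :=
  eventually_eventually_nhds.2 hX

theorem SmoothNear.congr (hX : SmoothNear X x) (h : ∀ᶠ y in 𝓝 x, Y y = X y) :
    SmoothNear Y x := by
  filter_upwards [hX.eventually, eventually_eventually_nhds.2 h] with y h1 h2
  exact h1.self.congr_of_eventuallyEq (h2.mono fun z hz ↦ by simp [hz])

theorem SmoothNear.add (hX : SmoothNear X x) (hY : SmoothNear Y x) : SmoothNear (X + Y) x := by
  filter_upwards [hX, hY] with y h1 h2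
  exact ContMDiffAt.add_section h1 h2

theorem SmoothNear.sub (hX : SmoothNear X x) (hY : SmoothNear Y x) : SmoothNear (X - Y) x := by
  filter_upwards [hX, hY] with y h1 h2
  exact ContMDiffAt.sub_section h1 h2

theorem SmoothNear.neg (hX : SmoothNear X x) : SmoothNear (-X) x := by
  filter_upwards [hX] with y h1
  exact ContMDiffAt.neg_section h1

theorem SmoothNear.smul (hf : ∀ᶠ y in 𝓝 x, CMDiffAt ∞ f y) (hX : SmoothNear X x) :
    SmoothNear (f • X) x := by
  filter_upwards [hX, hf] with y h1 h2
  exact ContMDiffAt.smul_section h2 h1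

theorem SmoothNear.const_smul (c : ℝ) (hX : SmoothNear X x) : SmoothNear (c • X) x := by
  filter_upwards [hX] with y h1
  exact ContMDiffAt.const_smul_section h1

theorem isManifold_minSmoothness (m : ℕ) : IsManifold I (minSmoothness ℝ m) M := by
  rw [minSmoothness_of_isRCLikeNormedField]
  infer_instance

variable [FiniteDimensional ℝ E]

theorem SmoothNear.mlieBracket (hX : SmoothNear X x) (hY : SmoothNear Y x) :
    SmoothNear (mlieBracket I X Y) x := by
  filter_upwards [hX, hY] with y h1 h2
  have : IsManifold I (((⊤ : ℕ∞) : ℕ∞ω) + 1) M := inferInstanceAs (IsManifold I ∞ M)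
  have : IsManifold I (minSmoothness ℝ 2) M := isManifold_minSmoothness 2
  have : CompleteSpace E := FiniteDimensional.complete ℝ E
  exact ContMDiffAt.mlieBracket_vectorField (m := ⊤) (n := ⊤) h1 h2 (by simp)

theorem jacobi {Z : Π x : M, TangentSpace I x}
    (hX : SmoothNear X x) (hY : SmoothNear Y x) (hZ : SmoothNear Z x) :
    VectorField.mlieBracket I X (VectorField.mlieBracket I Y Z) x =
      VectorField.mlieBracket I (VectorField.mlieBracket I X Y) Z x +
        VectorField.mlieBracket I Y (VectorField.mlieBracket I X Z) x := by
  have : IsManifold I (minSmoothness ℝ 3) M := isManifold_minSmoothness 3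
  have : CompleteSpace E := FiniteDimensional.complete ℝ E
  have h : minSmoothness ℝ 2 ≤ ∞ := by
    rw [minSmoothness_of_isRCLikeNormedField]
    exact ENat.LEInfty.out
  exact leibniz_identity_mlieBracket_apply (hX.self.of_le h) (hY.self.of_le h) (hZ.self.of_le h)

theorem smoothNear_extend (v : TangentSpace I x) : SmoothNear (FiberBundle.extend E v) x := by
  obtain ⟨s, hs, h⟩ := FiberBundle.exists_contMDiffOn_extend (k := ∞) I E v
  filter_upwards [eventually_mem_nhds_iff.2 hs] with y hy
  exact h.contMDiffAt hy

variable [RiemannianBundle (fun x : M ↦ TangentSpace I x)]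
  [IsContMDiffRiemannianBundle I ∞ E (fun x : M ↦ TangentSpace I x)]

theorem SmoothNear.inner (hX : SmoothNear X x) (hY : SmoothNear Y x) :
    ∀ᶠ y in 𝓝 x, CMDiffAt ∞ (fun y ↦ (inner ℝ (X y) (Y y) : ℝ)) y := by
  filter_upwards [hX, hY] with y h1 h2
  exact ContMDiffAt.inner_bundle h1 h2

/-- If some smooth field has unit length near `x`, derivatives of smooth functions along smooth
fields are smooth. -/
theorem eventually_contMDiffAt_mvfderiv {Z : Π x : M, TangentSpace I x}
    (hZ : SmoothNear Z x) (hZ1 : ∀ y, (inner ℝ (Z y) (Z y) : ℝ) = 1)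
    (hX : SmoothNear X x) (hf : ∀ᶠ y in 𝓝 x, CMDiffAt ∞ f y) :
    ∀ᶠ y in 𝓝 x, CMDiffAt ∞ (fun y ↦ mvfderiv I f y (X y)) y := by
  have hW : SmoothNear (VectorField.mlieBracket I X (f • Z)
      - f • VectorField.mlieBracket I X Z) x :=
    (hX.mlieBracket (hZ.smul hf)).sub ((hX.mlieBracket hZ).smul hf)
  have key : ∀ᶠ y in 𝓝 x, mvfderiv I f y (X y) =
      (inner ℝ ((VectorField.mlieBracket I X (f • Z)
        - f • VectorField.mlieBracket I X Z) y) (Z y) : ℝ) := by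
    filter_upwards [hZ, hf] with y h1 h2
    rw [Pi.sub_apply, mlieBracket_smul_right (h2.mdifferentiableAt (by simp))
      (h1.mdifferentiableAt (by simp))]
    simp [inner_smul_left, hZ1, -inner_self_eq_norm_sq_to_K]
  filter_upwards [hW.inner hZ, eventually_eventually_nhds.2 key] with y h1 h2
  exact h1.congr_of_eventuallyEq h2

/-- Jacobi's identity makes `[X, Y]` act on functions as a commutator. -/
theorem mvfderiv_mlieBracket {Z : Π x : M, TangentSpace I x}
    (hZ : SmoothNear Z x) (hZ1 : ∀ y, (inner ℝ (Z y) (Z y) : ℝ) = 1)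
    (hX : SmoothNear X x) (hY : SmoothNear Y x) (hf : ∀ᶠ y in 𝓝 x, CMDiffAt ∞ f y) :
    mvfderiv I f x (VectorField.mlieBracket I X Y x) =
      mvfderiv I (fun y ↦ mvfderiv I f y (Y y)) x (X x)
        - mvfderiv I (fun y ↦ mvfderiv I f y (X y)) x (Y x) := by
  have hfd := hf.self_of_nhds.mdifferentiableAt (n := ∞) (by simp)
  have expand : ∀ {V : Π x : M, TangentSpace I x}, ∀ᶠ y in 𝓝 x,
      VectorField.mlieBracket I V (f • Z) y =
        ((fun y ↦ mvfderiv I f y (V y)) • Z + f • VectorField.mlieBracket I V Z) y := by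
    intro V
    filter_upwards [hZ, hf] with y h1 h2
    rw [mlieBracket_smul_right (h2.mdifferentiableAt (by simp))
      (h1.mdifferentiableAt (by simp))]
    rfl
  have second : ∀ {U V : Π x : M, TangentSpace I x}, SmoothNear U x → SmoothNear V x →
      VectorField.mlieBracket I U (VectorField.mlieBracket I V (f • Z)) x =
        mvfderiv I (fun y ↦ mvfderiv I f y (V y)) x (U x) • Z x
        + mvfderiv I f x (V x) • VectorField.mlieBracket I U Z x
        + (mvfderiv I f x (U x) • VectorField.mlieBracket I V Z x
        + f x • VectorField.mlieBracket I U (VectorField.mlieBracket I V Z) x) := by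
    intro U V hU hV
    have hVf := eventually_contMDiffAt_mvfderiv hZ hZ1 hV hf
    rw [(Filter.EventuallyEq.refl _ U).mlieBracket_vectorField_eq expand,
      mlieBracket_add_right (hZ.smul hVf).mdifferentiableAt
        ((hV.mlieBracket hZ).smul hf).mdifferentiableAt,
      mlieBracket_smul_right (hVf.self_of_nhds.mdifferentiableAt (by simp)) hZ.mdifferentiableAt,
      mlieBracket_smul_right hfd (hV.mlieBracket hZ).mdifferentiableAt]
  have J := jacobi hX hY (hZ.smul hf)
  have J' := jacobi hX hY hZ
  rw [second hX hY, second hY hX, mlieBracket_smul_right hfd hZ.mdifferentiableAt, J'] at J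
  have h := congrArg (fun v : TangentSpace I x ↦ (inner ℝ v (Z x) : ℝ)) J
  simp only [inner_add_left, inner_smul_left, hZ1, RCLike.conj_to_real] at h
  linarith

end Fields
end KappaMu

namespace KappaMu

open scoped InnerProductSpace

namespace ContactMetricStructure

open Filter Topology

variable {E : Type*} [NormedAddCommGroup E] [NormedSpace ℝ E] [FiniteDimensional ℝ E]
  {H : Type*} [TopologicalSpace H] {I : ModelWithCorners ℝ E H}
  {M : Type*} [TopologicalSpace M] [ChartedSpace H M] [IsManifold I ∞ M]
  [RiemannianBundle (fun x : M ↦ TangentSpace I x)]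
  [IsContMDiffRiemannianBundle I ∞ E (fun x : M ↦ TangentSpace I x)]
  (S : ContactMetricStructure I M)

set_option linter.unusedSectionVars false

section Pointwise

variable {x : M} (v w : TangentSpace I x)

theorem inner_φ_right : ⟪v, S.φ x w⟫_ℝ = -⟪S.φ x v, w⟫_ℝ := by
  have h1 := S.contact x _ _ (smoothNear_extend v).self (smoothNear_extend w).self
  have h2 := S.contact x _ _ (smoothNear_extend w).self (smoothNear_extend v).self
  simp only [FiberBundle.extend_apply_self] at h1 h2
  rw [real_inner_comm w, ← h1, ← h2]
  simp only [dOneForm]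
  rw [mlieBracket_swap_apply, map_neg]
  ring

theorem η_eq_inner : S.η x v = ⟪v, S.ξ x⟫_ℝ := by
  have h := S.compatible x v (S.ξ x)
  rw [real_inner_comm, inner_φ_right, S.φ_sq, S.η_ξ] at h
  simp only [one_smul, neg_add_cancel, inner_zero_left, neg_zero, mul_one] at h
  linarith

theorem inner_ξ_ξ : ⟪S.ξ x, S.ξ x⟫_ℝ = 1 := by rw [← η_eq_inner, S.η_ξ]

theorem φ_ξ : S.φ x (S.ξ x) = 0 := by
  have h := S.compatible x (S.ξ x) (S.ξ x)
  rw [inner_ξ_ξ, S.η_ξ, mul_one, sub_self] at h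
  exact inner_self_eq_zero.1 h

theorem inner_φ_ξ : ⟪S.φ x v, S.ξ x⟫_ℝ = 0 := by
  have h := S.inner_φ_right v (S.ξ x)
  rw [φ_ξ, inner_zero_right] at h
  linarith

end Pointwise

theorem smoothNear_ξ (x : M) : SmoothNear S.ξ x := Eventually.of_forall S.smooth_ξ

theorem smoothNear_φ {X : Π x : M, TangentSpace I x} {x : M} (hX : SmoothNear X x) :
    SmoothNear (fun y ↦ S.φ y (X y)) x := by
  filter_upwards [hX] with y h1
  exact ContMDiffAt.clm_bundle_apply (S.smooth_φ y) h1

theorem smoothNear_h {X : Π x : M, TangentSpace I x} {x : M} (hX : SmoothNear X x) :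
    SmoothNear (fun y ↦ S.h y (X y)) x := by
  have h1 : SmoothNear ((1 / 2 : ℝ) • (mlieBracket I S.ξ (fun y ↦ S.φ y (X y))
      - fun y ↦ S.φ y (mlieBracket I S.ξ X y))) x :=
    (((S.smoothNear_ξ x).mlieBracket (S.smoothNear_φ hX)).sub
      (S.smoothNear_φ ((S.smoothNear_ξ x).mlieBracket hX))).const_smul _
  refine h1.congr ?_
  filter_upwards [hX.eventually] with y hy
  exact S.h_apply hy.mdifferentiableAt

/-- `L_ξ η = 0`. -/
theorem mvfderiv_inner_ξ {X : Π x : M, TangentSpace I x} {x : M} (hX : SmoothNear X x) :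
    mvfderiv I (fun y ↦ ⟪X y, S.ξ y⟫_ℝ) x (S.ξ x) = ⟪mlieBracket I S.ξ X x, S.ξ x⟫_ℝ := by
  have h := S.contact x S.ξ X (S.smooth_ξ x) hX.self
  rw [inner_φ_right, φ_ξ, inner_zero_left, neg_zero] at h
  simp only [dOneForm, η_eq_inner, inner_ξ_ξ, mvfderiv_const, zero_apply] at h
  linarith

/-- `L_ξ` annihilates the fundamental form. -/
theorem mvfderiv_inner_φ {X Y : Π x : M, TangentSpace I x} {x : M}
    (hX : SmoothNear X x) (hY : SmoothNear Y x) :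
    mvfderiv I (fun y ↦ ⟪X y, S.φ y (Y y)⟫_ℝ) x (S.ξ x) =
      ⟪mlieBracket I S.ξ X x, S.φ x (Y x)⟫_ℝ + ⟪X x, S.φ x (mlieBracket I S.ξ Y x)⟫_ℝ := by
  have hξ := S.smoothNear_ξ x
  have one : ∀ y, ⟪S.ξ y, S.ξ y⟫_ℝ = 1 := fun y ↦ S.inner_ξ_ξ
  have hXξ := hξ.mlieBracket hX
  have hYξ := hξ.mlieBracket hY
  have contact : ∀ {U V : Π x : M, TangentSpace I x} {y : M}, SmoothNear U y → SmoothNear V y →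
      2 * ⟪U y, S.φ y (V y)⟫_ℝ = mvfderiv I (fun z ↦ ⟪V z, S.ξ z⟫_ℝ) y (U y)
        - mvfderiv I (fun z ↦ ⟪U z, S.ξ z⟫_ℝ) y (V y) - ⟪mlieBracket I U V y, S.ξ y⟫_ℝ := by
    intro U V y hU hV
    rw [← S.contact y U V hU.self hV.self]
    simp only [dOneForm, η_eq_inner]
    ring
  have dX := eventually_contMDiffAt_mvfderiv hξ one hY (hX.inner hξ)
  have dY := eventually_contMDiffAt_mvfderiv hξ one hX (hY.inner hξ)
  have dB := ((hX.mlieBracket hY).inner hξ).self_of_nhds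
  have hd : ∀ {g : M → ℝ} {y : M}, CMDiffAt ∞ g y → MDiffAt g y :=
    fun h ↦ h.mdifferentiableAt (by simp)
  have hΦ : (fun y ↦ (2 : ℝ) * ⟪X y, S.φ y (Y y)⟫_ℝ) =ᶠ[𝓝 x]
      ((fun y ↦ mvfderiv I (fun z ↦ ⟪Y z, S.ξ z⟫_ℝ) y (X y))
        - (fun y ↦ mvfderiv I (fun z ↦ ⟪X z, S.ξ z⟫_ℝ) y (Y y))
        - fun y ↦ ⟪mlieBracket I X Y y, S.ξ y⟫_ℝ) := by
    filter_upwards [hX.eventually, hY.eventually] with y h1 h2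
    exact contact h1 h2
  have comm : ∀ {U V : Π x : M, TangentSpace I x}, SmoothNear U x → SmoothNear V x →
      mvfderiv I (fun y ↦ mvfderiv I (fun z ↦ ⟪V z, S.ξ z⟫_ℝ) y (U y)) x (S.ξ x) =
        mvfderiv I (fun z ↦ ⟪V z, S.ξ z⟫_ℝ) x (mlieBracket I S.ξ U x)
        + mvfderiv I (fun y ↦ ⟪mlieBracket I S.ξ V y, S.ξ y⟫_ℝ) x (U x) := by
    intro U V hU hV
    rw [mvfderiv_mlieBracket hξ one hξ hU (hV.inner hξ)]
    have : (fun y ↦ mvfderiv I (fun z ↦ ⟪V z, S.ξ z⟫_ℝ) y (S.ξ y)) =ᶠ[𝓝 x]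
        (fun y ↦ ⟪mlieBracket I S.ξ V y, S.ξ y⟫_ℝ) := by
      filter_upwards [hV.eventually] with y h1
      exact S.mvfderiv_inner_ξ h1
    rw [mvfderiv_congr_of_eventuallyEq this]
    ring
  have e1 := mvfderiv_congr_of_eventuallyEq (I := I) hΦ
  rw [mvfderiv_sub ((hd dY.self_of_nhds).sub (hd dX.self_of_nhds)) (hd dB),
    mvfderiv_sub (hd dY.self_of_nhds) (hd dX.self_of_nhds),
    mvfderiv_fun_mul mdifferentiableAt_const
      (hd (hX.inner (S.smoothNear_φ hY)).self_of_nhds), mvfderiv_const] at e1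
  have e2 := congrArg (fun L : TangentSpace I x →L[ℝ] ℝ ↦ L (S.ξ x)) e1
  simp only [sub_apply, smul_apply, smul_zero, add_zero, smul_eq_mul] at e2
  rw [comm hX hY, comm hY hX, S.mvfderiv_inner_ξ (hX.mlieBracket hY), jacobi hξ hX hY,
    inner_add_left] at e2
  have c1 := contact hXξ hY
  have c2 := contact hX hYξ
  linarith

end ContactMetricStructure
end KappaMu

namespace KappaMu

open scoped InnerProductSpace

namespace ContactMetricStructure

open Filter Topology

variable {E : Type*} [NormedAddCommGroup E] [NormedSpace ℝ E] [FiniteDimensional ℝ E]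
  {H : Type*} [TopologicalSpace H] {I : ModelWithCorners ℝ E H}
  {M : Type*} [TopologicalSpace M] [ChartedSpace H M] [IsManifold I ∞ M]
  [RiemannianBundle (fun x : M ↦ TangentSpace I x)]
  [IsContMDiffRiemannianBundle I ∞ E (fun x : M ↦ TangentSpace I x)]
  (S : ContactMetricStructure I M)

set_option linter.unusedSectionVars false

variable {cov : CovariantDerivative I E (fun x : M ↦ TangentSpace I x)} {x : M}

theorem _root_.KappaMu.IsLeviCivita.mlieBracket (hcov : IsLeviCivita cov)
    {X Y : Π x : M, TangentSpace I x} (hX : MDiffAt (T% X) x) (hY : MDiffAt (T% Y) x) :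
    VectorField.mlieBracket I X Y x = cov Y x (X x) - cov X x (Y x) := by
  have : CompleteSpace E := FiniteDimensional.complete ℝ E
  exact (cov.torsion_eq_zero_iff.1 hcov.2 hX hY).symm

theorem cov_neg {X : Π x : M, TangentSpace I x} (hX : MDiffAt (T% X) x) :
    cov (-X) x = -cov X x := by
  have h := cov.isCovariantDerivativeOnUniv.smul_const (-1 : ℝ) hX
  have e : -X = (-1 : ℝ) • X := by ext y; simp
  rw [e, h, neg_one_smul]

theorem inner_cov_ξ_sub (hcov : IsLeviCivita cov) (v w : TangentSpace I x) :
    ⟪cov S.ξ x v, w⟫_ℝ - ⟪cov S.ξ x w, v⟫_ℝ = 2 * ⟪v, S.φ x w⟫_ℝ := by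
  have hX := smoothNear_extend v
  have hY := smoothNear_extend w
  have hξ := (S.smoothNear_ξ x).mdifferentiableAt
  have h := S.contact x _ _ hX.self hY.self
  simp only [dOneForm, η_eq_inner, FiberBundle.extend_apply_self] at h
  rw [hcov.1 x v _ _ hY.mdifferentiableAt hξ, hcov.1 x w _ _ hX.mdifferentiableAt hξ,
    hcov.mlieBracket hX.mdifferentiableAt hY.mdifferentiableAt, inner_sub_left] at h
  simp only [FiberBundle.extend_apply_self] at h
  rw [← h, real_inner_comm, real_inner_comm v]
  ring

theorem inner_cov_ξ_ξ (hcov : IsLeviCivita cov) (v : TangentSpace I x) :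
    ⟪cov S.ξ x v, S.ξ x⟫_ℝ = 0 := by
  have hξ := (S.smoothNear_ξ x).mdifferentiableAt
  have h := hcov.1 x v _ _ hξ hξ
  simp only [inner_ξ_ξ, mvfderiv_const, zero_apply] at h
  rw [real_inner_comm (cov S.ξ x v)] at h
  linarith

theorem cov_ξ_ξ (hcov : IsLeviCivita cov) : cov S.ξ x (S.ξ x) = 0 := by
  refine ext_inner_right ℝ fun w ↦ ?_
  have h := S.inner_cov_ξ_sub hcov (S.ξ x) w
  rw [inner_cov_ξ_ξ S hcov, inner_φ_right, φ_ξ] at h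
  simp only [neg_zero, sub_zero, inner_zero_left, mul_zero] at h ⊢
  exact h

/-- The symmetric part of `∇ξ`. -/
noncomputable def symm (cov : CovariantDerivative I E (fun x : M ↦ TangentSpace I x)) (x : M) :
    TangentSpace I x →L[ℝ] TangentSpace I x :=
  cov S.ξ x + S.φ x

theorem cov_ξ_apply (v : TangentSpace I x) : cov S.ξ x v = S.symm cov x v - S.φ x v := by
  simp [symm]

theorem inner_symm (hcov : IsLeviCivita cov) (v w : TangentSpace I x) :
    ⟪S.symm cov x v, w⟫_ℝ = ⟪v, S.symm cov x w⟫_ℝ := by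
  have h := S.inner_cov_ξ_sub hcov v w
  have h2 := S.inner_φ_right v w
  simp only [symm, add_apply, inner_add_left, inner_add_right]
  rw [real_inner_comm v] at h
  linarith

theorem symm_ξ (hcov : IsLeviCivita cov) : S.symm cov x (S.ξ x) = 0 := by
  simp [symm, cov_ξ_ξ S hcov, φ_ξ]

theorem φ_φ_symm (hcov : IsLeviCivita cov) (v : TangentSpace I x) :
    S.φ x (S.φ x (S.symm cov x v)) = -S.symm cov x v := by
  rw [S.φ_sq, η_eq_inner, inner_symm S hcov, symm_ξ S hcov]
  simp

/-- `(∇_ξ φ) X = -(sym φ + φ sym) X`, from `L_ξ dη = 0`. -/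
theorem cov_φ (hcov : IsLeviCivita cov) {Y : Π x : M, TangentSpace I x} (hY : SmoothNear Y x) :
    cov (fun y ↦ S.φ y (Y y)) x (S.ξ x) - S.φ x (cov Y x (S.ξ x)) =
      -(S.symm cov x (S.φ x (Y x)) + S.φ x (S.symm cov x (Y x))) := by
  refine ext_inner_left ℝ fun v ↦ ?_
  have hX := smoothNear_extend v
  have hξ := (S.smoothNear_ξ x).mdifferentiableAt
  have h := S.mvfderiv_inner_φ hX hY
  rw [hcov.1 x _ _ _ hX.mdifferentiableAt (S.smoothNear_φ hY).mdifferentiableAt,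
    hcov.mlieBracket hξ hX.mdifferentiableAt, hcov.mlieBracket hξ hY.mdifferentiableAt] at h
  simp only [FiberBundle.extend_apply_self, cov_ξ_apply, map_sub, inner_sub_left,
    inner_sub_right] at h
  rw [inner_symm S hcov] at h
  have h2 := S.inner_φ_right v (S.φ x (Y x))
  simp only [inner_sub_right, inner_neg_right, inner_add_right]
  linarith

theorem symm_φ (hcov : IsLeviCivita cov) (v : TangentSpace I x) :
    S.symm cov x (S.φ x v) = -S.φ x (S.symm cov x v) := by
  have hX := smoothNear_extend v
  have hξ := S.smoothNear_ξ x
  have h1 := S.cov_φ hcov hX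
  have h2 := S.cov_φ hcov (S.smoothNear_φ hX)
  have e : (fun y ↦ S.φ y (S.φ y (FiberBundle.extend E v y))) =
      -FiberBundle.extend E v + (fun y ↦ ⟪FiberBundle.extend E v y, S.ξ y⟫_ℝ) • S.ξ := by
    ext y
    rw [S.φ_sq, η_eq_inner]
    rfl
  have hf := (hX.inner hξ).self_of_nhds.mdifferentiableAt (n := ∞) (by simp)
  have h3 : cov (fun y ↦ S.φ y (S.φ y (FiberBundle.extend E v y))) x (S.ξ x) =
      S.φ x (S.φ x (cov (FiberBundle.extend E v) x (S.ξ x))) := by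
    rw [e, cov.isCovariantDerivativeOnUniv.add hX.neg.mdifferentiableAt
      (hξ.smul (hX.inner hξ)).mdifferentiableAt, cov_neg hX.mdifferentiableAt,
      cov.isCovariantDerivativeOnUniv.leibniz hξ.mdifferentiableAt hf, S.φ_sq, η_eq_inner]
    simp only [add_apply, neg_apply, smul_apply, cov_ξ_ξ S hcov, ContinuousLinearMap.smulRight_apply,
      smul_zero, zero_add]
    rw [hcov.1 x _ _ _ hX.mdifferentiableAt hξ.mdifferentiableAt, cov_ξ_ξ S hcov, inner_zero_right,
      add_zero]
  rw [h3] at h2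
  have h4 := congrArg (S.φ x) h1
  simp only [FiberBundle.extend_apply_self, map_sub, map_neg, map_add] at h2 h4
  rw [φ_φ_symm S hcov, S.φ_sq x v, map_add, map_neg, map_smul, symm_ξ S hcov, smul_zero,
    add_zero] at *
  have h5 : S.φ x (S.symm cov x (S.φ x v)) = S.symm cov x v := by
    have h6 : (2 : ℝ) • (S.φ x (S.symm cov x (S.φ x v)) - S.symm cov x v) = 0 := by
      linear_combination (norm := module) (1 : ℝ) • h2 + (1 : ℝ) • h4
    exact sub_eq_zero.1 ((smul_eq_zero.1 h6).resolve_left two_ne_zero)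
  have h7 := S.φ_φ_symm hcov (S.φ x v)
  rw [h5] at h7
  rw [h7, neg_neg]

/-- `∇_ξ φ = 0`. -/
theorem cov_φ_apply (hcov : IsLeviCivita cov) {Y : Π x : M, TangentSpace I x}
    (hY : SmoothNear Y x) :
    cov (fun y ↦ S.φ y (Y y)) x (S.ξ x) = S.φ x (cov Y x (S.ξ x)) := by
  have h := S.cov_φ hcov hY
  rw [symm_φ S hcov, neg_add_cancel, neg_zero] at h
  exact sub_eq_zero.1 h

theorem h_eq (hcov : IsLeviCivita cov) (v : TangentSpace I x) :
    S.h x v = S.φ x (S.symm cov x v) := by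
  have hX := smoothNear_extend v
  have hξ := (S.smoothNear_ξ x).mdifferentiableAt
  have h := S.h_apply hX.mdifferentiableAt
  rw [hcov.mlieBracket hξ hX.mdifferentiableAt,
    hcov.mlieBracket hξ (S.smoothNear_φ hX).mdifferentiableAt, S.cov_φ_apply hcov hX] at h
  simp only [FiberBundle.extend_apply_self, cov_ξ_apply, map_sub, symm_φ S hcov] at h
  rw [h]
  module

theorem φ_h (hcov : IsLeviCivita cov) (v : TangentSpace I x) :
    S.φ x (S.h x v) = -S.symm cov x v := by
  rw [h_eq S hcov, φ_φ_symm S hcov]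

theorem cov_ξ_eq (hcov : IsLeviCivita cov) (v : TangentSpace I x) :
    cov S.ξ x v = -S.φ x v - S.φ x (S.h x v) := by
  rw [φ_h S hcov, cov_ξ_apply]
  abel

theorem h_φ (hcov : IsLeviCivita cov) (v : TangentSpace I x) :
    S.h x (S.φ x v) = -S.φ x (S.h x v) := by
  rw [h_eq S hcov, h_eq S hcov, symm_φ S hcov, map_neg]

theorem h_ξ (hcov : IsLeviCivita cov) : S.h x (S.ξ x) = 0 := by
  rw [h_eq S hcov, symm_ξ S hcov, map_zero]

theorem inner_h (hcov : IsLeviCivita cov) (v w : TangentSpace I x) :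
    ⟪S.h x v, w⟫_ℝ = ⟪v, S.h x w⟫_ℝ := by
  have h := S.inner_φ_right (S.symm cov x v) w
  rw [h_eq S hcov, h_eq S hcov, ← neg_neg (S.φ x (S.symm cov x w)), ← symm_φ S hcov,
    inner_neg_right, ← inner_symm S hcov, h, neg_neg]

theorem inner_h_ξ (hcov : IsLeviCivita cov) (v : TangentSpace I x) : ⟪S.h x v, S.ξ x⟫_ℝ = 0 := by
  rw [inner_h S hcov, h_ξ S hcov, inner_zero_right]

theorem φ_φ_h (hcov : IsLeviCivita cov) (v : TangentSpace I x) :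
    S.φ x (S.φ x (S.h x v)) = -S.h x v := by
  rw [S.φ_sq, η_eq_inner, inner_h_ξ S hcov, zero_smul, add_zero]

/-- The Jacobi operator of the characteristic field. -/
theorem curvature_ξ (hcov : IsLeviCivita cov) {X : Π x : M, TangentSpace I x}
    (hX : SmoothNear X x) :
    curvature cov X S.ξ S.ξ x =
      S.φ x (cov (fun y ↦ S.h y (X y)) x (S.ξ x) - S.h x (cov X x (S.ξ x)))
        - S.φ x (S.φ x (X x)) - S.h x (S.h x (X x)) := by
  have hξ := (S.smoothNear_ξ x).mdifferentiableAt
  have e1 : (fun y ↦ cov S.ξ y (S.ξ y)) = 0 := by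
    ext y
    exact cov_ξ_ξ S hcov
  have e2 : (fun y ↦ cov S.ξ y (X y)) =
      -(fun y ↦ S.φ y (X y)) + -(fun y ↦ S.φ y (S.h y (X y))) := by
    ext y
    rw [cov_ξ_eq S hcov, sub_eq_add_neg]
    rfl
  have hφX := S.smoothNear_φ hX
  have hhX := S.smoothNear_h hX
  have hφhX := S.smoothNear_φ hhX
  rw [curvature, e1, e2, hcov.mlieBracket hX.mdifferentiableAt hξ, cov.zero,
    cov.isCovariantDerivativeOnUniv.add hφX.neg.mdifferentiableAt hφhX.neg.mdifferentiableAt,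
    cov_neg hφX.mdifferentiableAt, cov_neg hφhX.mdifferentiableAt]
  simp only [Pi.zero_apply, zero_apply, add_apply, neg_apply, S.cov_φ_apply hcov hX,
    S.cov_φ_apply hcov hhX, cov_ξ_eq S hcov, map_sub, map_neg, h_φ S hcov, φ_φ_h S hcov]
  abel

/-- On a `(κ, μ)`-space, `h² = (κ - 1) φ²`. -/
theorem h_h {κ μ : ℝ} (hcov : IsLeviCivita cov)
    (hR : ∀ (x : M) (X Y : Π x : M, TangentSpace I x), SmoothFieldAt X x → SmoothFieldAt Y x →
      curvature cov X Y S.ξ x =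
        κ • (S.η x (Y x) • X x - S.η x (X x) • Y x) +
        μ • (S.η x (Y x) • S.h x (X x) - S.η x (X x) • S.h x (Y x)))
    (v : TangentSpace I x) :
    S.h x (S.h x v) = (κ - 1) • S.φ x (S.φ x v) := by
  have hX := smoothNear_extend v
  have hφX := S.smoothNear_φ hX
  have hhX := S.smoothNear_h hX
  have h1 := hR x _ _ hX.self (S.smooth_ξ x)
  have h2 := hR x _ _ hφX.self (S.smooth_ξ x)
  rw [S.curvature_ξ hcov hX] at h1
  rw [S.curvature_ξ hcov hφX] at h2
  have e : (fun y ↦ S.h y (S.φ y (FiberBundle.extend E v y))) =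
      -(fun y ↦ S.φ y (S.h y (FiberBundle.extend E v y))) := by
    ext y
    exact h_φ S hcov _
  have hη : S.η x (S.φ x v) = 0 := by rw [η_eq_inner, inner_φ_ξ]
  have e3 : ∀ w, S.φ x (S.φ x (S.φ x w)) = -S.φ x w := by
    intro w
    rw [S.φ_sq, η_eq_inner, inner_φ_ξ, zero_smul, add_zero]
  rw [e, cov_neg (S.smoothNear_φ hhX).mdifferentiableAt, neg_apply, S.cov_φ_apply hcov hhX,
    S.cov_φ_apply hcov hX] at h2
  have h3 := congrArg (S.φ x) h2
  simp only [FiberBundle.extend_apply_self, map_sub, map_neg, map_add, map_smul, h_φ S hcov, hη,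
    φ_φ_h S hcov, h_ξ S hcov, S.η_ξ, e3, one_smul, zero_smul, smul_zero, sub_zero, neg_neg] at h1 h3
  have e4 : v - S.η x v • S.ξ x = -S.φ x (S.φ x v) := by rw [S.φ_sq]; abel
  rw [e4] at h1
  linear_combination (norm := module) (1 / 2 : ℝ) • h3 - (1 / 2 : ℝ) • h1

end ContactMetricStructure
end KappaMu

namespace KappaMu

open scoped InnerProductSpace

open Filter Topology

set_option linter.unusedSectionVars false

section ChartField

variable {E : Type*} [NormedAddCommGroup E] [NormedSpace ℝ E] [FiniteDimensional ℝ E]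
  {H : Type*} [TopologicalSpace H] (I : ModelWithCorners ℝ E H)
  {M : Type*} [TopologicalSpace M] [ChartedSpace H M] [IsManifold I ∞ M]

/-- The vector field near `x₀` with constant value `e` in the chart at `x₀`. -/
noncomputable def chartField (x₀ : M) (e : E) : Π y : M, TangentSpace I y :=
  mpullback I 𝓘(ℝ, E) (extChartAt I x₀) (fun _ ↦ e)

variable {I} {x₀ : M}

theorem smoothNear_chartField (e : E) {y : M} (hy : y ∈ (extChartAt I x₀).source) :
    SmoothNear (chartField I x₀ e) y := by
  have : CompleteSpace E := FiniteDimensional.complete ℝ E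
  filter_upwards [(isOpen_extChartAt_source x₀).mem_nhds hy] with z hz
  refine ContMDiffAt.mpullback_vectorField_preimage (n := ∞) ?_
    (contMDiffAt_extChartAt' (by rwa [extChartAt_source] at hz))
    (isInvertible_mfderiv_extChartAt hz) (by simp)
  exact contMDiffAt_vectorSpace_iff_contDiffAt.2 contDiffAt_const

theorem chartField_add (a b : E) (y : M) :
    chartField I x₀ (a + b) y = chartField I x₀ a y + chartField I x₀ b y :=
  map_add (mfderiv I 𝓘(ℝ, E) (extChartAt I x₀) y).inverse a b

theorem chartField_smul (r : ℝ) (a : E) (y : M) :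
    chartField I x₀ (r • a) y = r • chartField I x₀ a y :=
  map_smul (mfderiv I 𝓘(ℝ, E) (extChartAt I x₀) y).inverse r a

theorem mlieBracket_chartField (e e' : E) :
    mlieBracket I (chartField I x₀ e) (chartField I x₀ e') x₀ = 0 := by
  have : CompleteSpace E := FiniteDimensional.complete ℝ E
  have : IsManifold I (minSmoothness ℝ 3) M := isManifold_minSmoothness 3
  have hc : ∀ a : E, MDifferentiableAt 𝓘(ℝ, E) 𝓘(ℝ, E).tangent
      (fun y : E ↦ (⟨y, a⟩ : TangentBundle 𝓘(ℝ, E) E)) (extChartAt I x₀ x₀) := fun a ↦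
    ((contMDiffAt_vectorSpace_iff_contDiffAt (V := fun _ ↦ a)).2
      (contDiffAt_const (n := 1))).mdifferentiableAt (by simp)
  have h2 : minSmoothness ℝ 2 ≤ (∞ : ℕ∞ω) := by
    rw [minSmoothness_of_isRCLikeNormedField]
    exact ENat.LEInfty.out
  rw [chartField, chartField, ← mpullback_mlieBracket (n := ∞) (hc e) (hc e')
    contMDiffAt_extChartAt h2, mpullback_apply]
  have h0 : ∀ V W : Π y : E, TangentSpace 𝓘(ℝ, E) y, V = (fun _ ↦ e) → W = (fun _ ↦ e') →
      mlieBracket 𝓘(ℝ, E) V W (extChartAt I x₀ x₀) = 0 := by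
    intro V W hV hW
    rw [← mlieBracketWithin_univ, mlieBracketWithin_eq_lieBracketWithin, hV, hW]
    simp [lieBracketWithin]
    rfl
  exact (congrArg (mfderiv I 𝓘(ℝ, E) (extChartAt I x₀) x₀).inverse (h0 _ _ rfl rfl)).trans (map_zero _)

theorem chartField_mfderiv {y : M} (hy : y ∈ (extChartAt I x₀).source) (u : TangentSpace I y) :
    chartField I x₀ (mfderiv I 𝓘(ℝ, E) (extChartAt I x₀) y u) y = u :=
  (isInvertible_mfderiv_extChartAt hy).inverse_apply_self u

end ChartField

namespace ContactMetricStructure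

variable {E : Type*} [NormedAddCommGroup E] [NormedSpace ℝ E] [FiniteDimensional ℝ E]
  {H : Type*} [TopologicalSpace H] {I : ModelWithCorners ℝ E H}
  {M : Type*} [TopologicalSpace M] [ChartedSpace H M] [IsManifold I ∞ M]
  [RiemannianBundle (fun x : M ↦ TangentSpace I x)]
  [IsContMDiffRiemannianBundle I ∞ E (fun x : M ↦ TangentSpace I x)]
  (S : ContactMetricStructure I M)
  {E' : Type*} [NormedAddCommGroup E'] [NormedSpace ℝ E']
  {H' : Type*} [TopologicalSpace H'] {J : ModelWithCorners ℝ E' H'}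
  {N : Type*} [TopologicalSpace N] [ChartedSpace H' N]

/-- If `g^*η = 0` near `z₀` for a map `g` from a vector space, then `g^*dη = 0` at `z₀`. -/
theorem inner_φ_mfderiv_eq_zero {g : E' → M} {U : Set E'} (hU : IsOpen U)
    (hg : ContMDiffOn 𝓘(ℝ, E') I ∞ g U)
    (hη : ∀ z ∈ U, ∀ v : E', ⟪S.ξ (g z), mfderiv 𝓘(ℝ, E') I g z v⟫_ℝ = 0)
    {z₀ : E'} (hz₀ : z₀ ∈ U) (v w : E') :
    ⟪mfderiv 𝓘(ℝ, E') I g z₀ w, S.φ (g z₀) (mfderiv 𝓘(ℝ, E') I g z₀ v)⟫_ℝ = 0 := by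
  set x₀ := g z₀
  let κ := extChartAt I x₀
  let U' := U ∩ g ⁻¹' κ.source
  have hU' : IsOpen U' := hg.continuousOn.isOpen_inter_preimage hU (isOpen_extChartAt_source x₀)
  have hz₀' : z₀ ∈ U' := ⟨hz₀, mem_extChartAt_source x₀⟩
  have hgA : ∀ z ∈ U', ContMDiffAt 𝓘(ℝ, E') I ∞ g z := fun z hz ↦
    hg.contMDiffAt (hU.mem_nhds hz.1)
  have hgd : ∀ z ∈ U', MDifferentiableAt 𝓘(ℝ, E') I g z := fun z hz ↦
    (hgA z hz).mdifferentiableAt (by simp)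
  have hκ : ∀ z ∈ U', ContMDiffAt I 𝓘(ℝ, E) ∞ κ (g z) := fun z hz ↦
    contMDiffAt_extChartAt' (by simpa [κ] using hz.2)
  let c : E' → E := fun z ↦ κ (g z)
  have hc : ContDiffOn ℝ ∞ c U' := fun z hz ↦
    (contMDiffAt_iff_contDiffAt.1 ((hκ z hz).comp z (hgA z hz))).contDiffWithinAt
  have hcd : ∀ z ∈ U', ∀ v : E', (fderiv ℝ c z v : E) =
      mfderiv I 𝓘(ℝ, E) κ (g z) (mfderiv 𝓘(ℝ, E') I g z v) := by
    intro z hz v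
    rw [← mfderiv_eq_fderiv]
    exact mfderiv_comp_apply z ((hκ z hz).mdifferentiableAt (by simp)) (hgd z hz) v
  have hX : ∀ z ∈ U', ∀ v : E',
      chartField I x₀ (fderiv ℝ c z v) (g z) = mfderiv 𝓘(ℝ, E') I g z v := by
    intro z hz v
    rw [hcd z hz]
    exact chartField_mfderiv hz.2 _
  let β : E → M → ℝ := fun e y ↦ ⟪chartField I x₀ e y, S.ξ y⟫_ℝ
  have hβ : ∀ e, ∀ z ∈ U', CMDiffAt ∞ (β e) (g z) := fun e z hz ↦
    ((smoothNear_chartField e hz.2).inner (S.smoothNear_ξ _)).self_of_nhds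
  let α : E' → E →L[ℝ] ℝ := fun z ↦ LinearMap.toContinuousLinearMap
    { toFun := fun e ↦ β e (g z)
      map_add' := fun a b ↦ by simp only [β, chartField_add, inner_add_left]
      map_smul' := fun a b ↦ by simp [β, chartField_smul, real_inner_smul_left] }
  have hα : ContDiffOn ℝ ∞ α U' := contDiffOn_clm_apply.2 fun e z hz ↦
    (contMDiffAt_iff_contDiffAt.1 ((hβ e z hz).comp z (hgA z hz))).contDiffWithinAt
  have hαd : DifferentiableAt ℝ α z₀ :=
    (hα.contDiffAt (hU'.mem_nhds hz₀')).differentiableAt (by simp)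
  have hc2 : ContDiffAt ℝ ∞ c z₀ := hc.contDiffAt (hU'.mem_nhds hz₀')
  have hcd2 : DifferentiableAt ℝ (fderiv ℝ c) z₀ :=
    (hc2.fderiv_right (m := 1) (by rw [one_add_one_eq_two]; exact ENat.LEInfty.out)).differentiableAt (by simp)
  have dα : ∀ (e : E) (w : E'), fderiv ℝ α z₀ w e =
      mvfderiv I (β e) x₀ (mfderiv 𝓘(ℝ, E') I g z₀ w) := by
    intro e w
    have h1 : fderiv ℝ (fun z ↦ α z e) z₀ w = fderiv ℝ α z₀ w e := by
      rw [fderiv_clm_apply hαd (differentiableAt_const e)]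
      simp
    rw [← h1, ← mfderiv_eq_fderiv]
    exact mfderiv_comp_apply z₀ ((hβ e z₀ hz₀').mdifferentiableAt (by simp)) (hgd z₀ hz₀') w
  have dF : ∀ v w : E', α z₀ (fderiv ℝ (fderiv ℝ c) z₀ w v)
      + fderiv ℝ α z₀ w (fderiv ℝ c z₀ v) = 0 := by
    intro v w
    have h0 : (fun z ↦ α z (fderiv ℝ c z v)) =ᶠ[𝓝 z₀] fun _ ↦ 0 := by
      filter_upwards [hU'.mem_nhds hz₀'] with z hz
      change ⟪chartField I x₀ (fderiv ℝ c z v) (g z), S.ξ (g z)⟫_ℝ = 0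
      rw [hX z hz, real_inner_comm]
      exact hη z hz.1 v
    have h1 := h0.fderiv_eq (𝕜 := ℝ)
    rw [fderiv_clm_apply hαd (hcd2.clm_apply (differentiableAt_const v)),
      fderiv_clm_apply hcd2 (differentiableAt_const v)] at h1
    simpa using congrArg (fun L : E' →L[ℝ] ℝ ↦ L w) h1
  have hsymm : fderiv ℝ (fderiv ℝ c) z₀ w v = fderiv ℝ (fderiv ℝ c) z₀ v w :=
    (hc2.isSymmSndFDerivAt (by simp; exact ENat.LEInfty.out)).eq w v
  have hcont := S.contact x₀ (chartField I x₀ (fderiv ℝ c z₀ w))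
    (chartField I x₀ (fderiv ℝ c z₀ v)) (smoothNear_chartField _ hz₀'.2).self
    (smoothNear_chartField _ hz₀'.2).self
  rw [hX z₀ hz₀', hX z₀ hz₀'] at hcont
  rw [← hcont]
  simp only [dOneForm, η_eq_inner]
  rw [mlieBracket_chartField, inner_zero_left, hX z₀ hz₀', hX z₀ hz₀']
  have h1 := dF v w
  have h2 := dF w v
  rw [dα] at h1 h2
  rw [hsymm] at h1
  simp only [β] at h1 h2
  linarith

theorem inner_φ_mfderiv_of_normal [IsManifold J ∞ N] [J.Boundaryless] {f : N → M}
    (hf : ContMDiff J I ∞ f)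
    (hη : ∀ (p : N) (v : TangentSpace J p), ⟪S.ξ (f p), mfderiv J I f p v⟫_ℝ = 0)
    (p : N) (v w : TangentSpace J p) :
    ⟪mfderiv J I f p v, S.φ (f p) (mfderiv J I f p w)⟫_ℝ = 0 := by
  have hΓ := contMDiffOn_extChartAt_symm (I := J) (n := ∞) p
  have hopen : IsOpen (extChartAt J p).target := isOpen_extChartAt_target p
  have hz := mem_extChartAt_target (I := J) p
  have hd : ∀ z ∈ (extChartAt J p).target, MDifferentiableAt 𝓘(ℝ, E') J (extChartAt J p).symm z := fun z hz ↦
    (hΓ.contMDiffAt (hopen.mem_nhds hz)).mdifferentiableAt (by simp)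
  have hcomp : ∀ z ∈ (extChartAt J p).target, ∀ u : E', mfderiv 𝓘(ℝ, E') I (f ∘ (extChartAt J p).symm) z u =
      mfderiv J I f ((extChartAt J p).symm z) (mfderiv 𝓘(ℝ, E') J (extChartAt J p).symm z u) := fun z hz u ↦
    mfderiv_comp_apply z ((hf _).mdifferentiableAt (by simp)) (hd z hz) u
  have key : ∀ v w : TangentSpace J ((extChartAt J p).symm (extChartAt J p p)),
      ⟪mfderiv J I f ((extChartAt J p).symm (extChartAt J p p)) v,
        S.φ (f ((extChartAt J p).symm (extChartAt J p p))) (mfderiv J I f ((extChartAt J p).symm (extChartAt J p p)) w)⟫_ℝ = 0 := by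
    have hinv := isInvertible_mfderivWithin_extChartAt_symm hz
    rw [J.range_eq_univ, mfderivWithin_univ] at hinv
    intro v w
    obtain ⟨v', rfl⟩ := hinv.bijective.2 v
    obtain ⟨w', rfl⟩ := hinv.bijective.2 w
    have h := S.inner_φ_mfderiv_eq_zero hopen (hf.comp_contMDiffOn hΓ)
      (fun z hz u ↦ by rw [hcomp z hz]; exact hη _ _) hz w' v'
    have e := congrArg₂ (fun a b : TangentSpace I (f ((extChartAt J p).symm (extChartAt J p p))) ↦
      ⟪a, S.φ _ b⟫_ℝ) (hcomp _ hz v') (hcomp _ hz w')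
    exact e.symm.trans h
  rw [show (extChartAt J p).symm (extChartAt J p p) = p from extChartAt_to_inv p] at key
  exact key v w

end ContactMetricStructure
end KappaMu

namespace KappaMu

open scoped InnerProductSpace

section LinearAlgebra

variable {P T : Type*} [AddCommGroup P] [Module ℝ P]
  [NormedAddCommGroup T] [InnerProductSpace ℝ T]

/-- For a totally real `n`-dimensional subspace `D(P)` orthogonal to the unit vector `ξ` of a
`(2n+1)`-dimensional space, the sum `D u + φ D w` determines `u` and `w`. -/
theorem eq_zero_of_add_eq_zero {D : P →ₗ[ℝ] T} {φ : T →ₗ[ℝ] T} {ξ : T}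
    (hD : Function.Injective D) (hDξ : ∀ u, ⟪D u, ξ⟫_ℝ = 0) (hDφ : ∀ u w, ⟪D u, φ (D w)⟫_ℝ = 0)
    (hφφ : ∀ v, φ (φ v) = -v + ⟪v, ξ⟫_ℝ • ξ)
    {u w : P} (h : D u + φ (D w) = 0) : u = 0 ∧ w = 0 := by
  have hu : D u = 0 := by
    have h1 := congrArg (fun t ↦ ⟪D u, t⟫_ℝ) h
    simp only [inner_add_right, hDφ, add_zero, inner_zero_right] at h1
    exact inner_self_eq_zero.1 h1
  have hw : D w = 0 := by
    rw [hu, zero_add] at h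
    have h1 := congrArg φ h
    rw [hφφ, hDξ, zero_smul, add_zero, map_zero] at h1
    exact neg_eq_zero.1 h1
  exact ⟨hD (hu.trans (map_zero D).symm), hD (hw.trans (map_zero D).symm)⟩

theorem eq_of_add_eq_add {D : P →ₗ[ℝ] T} {φ : T →ₗ[ℝ] T} {ξ : T}
    (hD : Function.Injective D) (hDξ : ∀ u, ⟪D u, ξ⟫_ℝ = 0) (hDφ : ∀ u w, ⟪D u, φ (D w)⟫_ℝ = 0)
    (hφφ : ∀ v, φ (φ v) = -v + ⟪v, ξ⟫_ℝ • ξ)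
    {u w u' w' : P} (h : D u + φ (D w) = D u' + φ (D w')) : u = u' ∧ w = w' := by
  have h0 : D (u - u') + φ (D (w - w')) = 0 := by
    simp only [map_sub]
    linear_combination (norm := module) (1 : ℝ) • h
  have h1 := eq_zero_of_add_eq_zero hD hDξ hDφ hφφ h0
  exact ⟨sub_eq_zero.1 h1.1, sub_eq_zero.1 h1.2⟩

variable [FiniteDimensional ℝ P] [FiniteDimensional ℝ T]

/-- The tangent and normal parts of a symmetric operator `h` anticommuting with `φ` and with
`h² = (κ - 1) φ²`. -/
theorem exists_tangent_normal_parts {D : P →ₗ[ℝ] T} {φ h : T →ₗ[ℝ] T} {ξ : T} {κ : ℝ} {n : ℕ}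
    (hP : Module.finrank ℝ P = n) (hT : Module.finrank ℝ T = 2 * n + 1)
    (hD : Function.Injective D) (hDξ : ∀ u, ⟪D u, ξ⟫_ℝ = 0) (hDφ : ∀ u w, ⟪D u, φ (D w)⟫_ℝ = 0)
    (hξξ : ⟪ξ, ξ⟫_ℝ = 1) (hφ : ∀ v w, ⟪v, φ w⟫_ℝ = -⟪φ v, w⟫_ℝ)
    (hφφ : ∀ v, φ (φ v) = -v + ⟪v, ξ⟫_ℝ • ξ) (hφξ : φ ξ = 0)
    (hh : ∀ v w, ⟪h v, w⟫_ℝ = ⟪v, h w⟫_ℝ) (hhφ : ∀ v, h (φ v) = -φ (h v)) (hhξ : h ξ = 0)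
    (hhh : ∀ v, h (h v) = (κ - 1) • φ (φ v)) :
    ∃ h₁ h₂ : P →ₗ[ℝ] P, (∀ X, h (D X) = D (h₁ X) + φ (D (h₂ X))) ∧
      (∀ X Y, ⟪D (h₁ X), D Y⟫_ℝ = ⟪D X, D (h₁ Y)⟫_ℝ) ∧
      (∀ X Y, ⟪D (h₂ X), D Y⟫_ℝ = ⟪D X, D (h₂ Y)⟫_ℝ) ∧
      h₁ ∘ₗ h₁ + h₂ ∘ₗ h₂ = (1 - κ) • LinearMap.id ∧ h₁ ∘ₗ h₂ = h₂ ∘ₗ h₁ := by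
  let B : (P × P) × ℝ →ₗ[ℝ] T :=
    (D.coprod (φ ∘ₗ D)).coprod (LinearMap.toSpanSingleton ℝ T ξ)
  have hB : ∀ u w r, B ((u, w), r) = D u + φ (D w) + r • ξ := fun u w r ↦ by simp [B]
  have hφ0 : ∀ v, ⟪φ v, ξ⟫_ℝ = 0 := fun v ↦ by
    have h1 := hφ v ξ
    rw [hφξ, inner_zero_right] at h1
    linarith
  have hB0 : ∀ u w r, ⟪B ((u, w), r), ξ⟫_ℝ = r := fun u w r ↦ by
    rw [hB, inner_add_left, inner_add_left, hDξ, hφ0, real_inner_smul_left, hξξ]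
    ring
  have hinj : Function.Injective B := by
    rw [← LinearMap.ker_eq_bot, LinearMap.ker_eq_bot']
    rintro ⟨⟨u, w⟩, r⟩ h0
    have hr : r = 0 := by rw [← hB0 u w r, h0, inner_zero_left]
    rw [hB, hr, zero_smul, add_zero] at h0
    obtain ⟨rfl, rfl⟩ := eq_zero_of_add_eq_zero hD hDξ hDφ hφφ h0
    rw [hr]
    rfl
  let e : ((P × P) × ℝ) ≃ₗ[ℝ] T := LinearEquiv.ofInjectiveOfFinrankEq B hinj (by
    simp [hP, hT]; ring)
  have he : ∀ q, e q = B q := fun q ↦ rfl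
  let h₁ : P →ₗ[ℝ] P := LinearMap.fst ℝ P P ∘ₗ LinearMap.fst ℝ (P × P) ℝ ∘ₗ
    e.symm.toLinearMap ∘ₗ h ∘ₗ D
  let h₂ : P →ₗ[ℝ] P := LinearMap.snd ℝ P P ∘ₗ LinearMap.fst ℝ (P × P) ℝ ∘ₗ
    e.symm.toLinearMap ∘ₗ h ∘ₗ D
  have split : ∀ X, h (D X) = D (h₁ X) + φ (D (h₂ X)) := by
    intro X
    have h1 : B ((h₁ X, h₂ X), (e.symm (h (D X))).2) = h (D X) := by
      rw [← he]
      exact e.apply_symm_apply (h (D X))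
    have h2 := hB0 (h₁ X) (h₂ X) (e.symm (h (D X))).2
    rw [h1, hh, hhξ, inner_zero_right] at h2
    rw [hB, ← h2, zero_smul, add_zero] at h1
    exact h1.symm
  have hφD : ∀ u w, ⟪φ (D u), D w⟫_ℝ = 0 := fun u w ↦ by rw [real_inner_comm, hDφ]
  have hisom : ∀ u w, ⟪φ (D u), φ (D w)⟫_ℝ = ⟪D u, D w⟫_ℝ := by
    intro u w
    rw [hφ, hφφ, hDξ, zero_smul, add_zero, inner_neg_left, neg_neg]
  have comp : ∀ X, D (h₁ (h₁ X) + h₂ (h₂ X) - (1 - κ) • X)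
      + φ (D (h₂ (h₁ X) - h₁ (h₂ X))) = 0 := by
    intro X
    have h1 := hhh (D X)
    rw [split, map_add, hhφ, split, split, hφφ (D X), hDξ, map_add, hφφ, hDξ] at h1
    simp only [map_add, map_sub, map_smul]
    linear_combination (norm := module) (1 : ℝ) • h1
  have comp' := fun X ↦ eq_zero_of_add_eq_zero hD hDξ hDφ hφφ (comp X)
  refine ⟨h₁, h₂, split, fun X Y ↦ ?_, fun X Y ↦ ?_, ?_, ?_⟩
  · have h1 := hh (D X) (D Y)
    rw [split, split, inner_add_left, inner_add_right, hφD, hDφ] at h1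
    linarith
  · have h1 : ⟪h (D X), φ (D Y)⟫_ℝ = ⟪D (h₂ X), D Y⟫_ℝ := by
      rw [split, inner_add_left, hDφ, hisom, zero_add]
    have h2 : ⟪φ (D X), h (D Y)⟫_ℝ = ⟪D X, D (h₂ Y)⟫_ℝ := by
      rw [split, inner_add_right, hφD, hisom, zero_add]
    rw [← h1, ← h2, hh, hhφ, inner_neg_right, hφ, neg_neg]
  · ext X
    exact sub_eq_zero.1 (comp' X).1
  · ext X
    exact (sub_eq_zero.1 (comp' X).2).symm

end LinearAlgebra
section Legendrian

variable {n : ℕ}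
  {M : Type*} [TopologicalSpace M] [ChartedSpace (EuclideanSpace ℝ (Fin (2 * n + 1))) M]
  [IsManifold (𝓡 (2 * n + 1)) ∞ M]
  [RiemannianBundle (fun x : M ↦ TangentSpace (𝓡 (2 * n + 1)) x)]
  [IsContMDiffRiemannianBundle (𝓡 (2 * n + 1)) ∞ (EuclideanSpace ℝ (Fin (2 * n + 1)))
    (fun x : M ↦ TangentSpace (𝓡 (2 * n + 1)) x)]
  {N : Type*} [TopologicalSpace N] [ChartedSpace (EuclideanSpace ℝ (Fin n)) N]
  {S : ContactMetricStructure (𝓡 (2 * n + 1)) M} {f : N → M}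

theorem ContactMetricStructure.φ_φ {x : M} (v : TangentSpace (𝓡 (2 * n + 1)) x) :
    S.φ x (S.φ x v) = -v + (inner ℝ v (S.ξ x) : ℝ) • S.ξ x := by
  rw [S.φ_sq, S.η_eq_inner]

theorem IsLegendrian.inner_ξ (hf : IsLegendrian S f) (p : N) (u : TangentSpace (𝓡 n) p) :
    inner ℝ (df (n := n) f p u) (S.ξ (f p)) = (0 : ℝ) := by
  rw [real_inner_comm]
  exact hf.normal p u

theorem IsLegendrian.inner_φ [IsManifold (𝓡 n) ∞ N] (hf : IsLegendrian S f) (p : N)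
    (u w : TangentSpace (𝓡 n) p) :
    inner ℝ (df (n := n) f p u) (S.φ (f p) (df (n := n) f p w)) = (0 : ℝ) :=
  S.inner_φ_mfderiv_of_normal hf.smooth hf.normal p u w

theorem IsLegendrian.eq_of_add_eq_add [IsManifold (𝓡 n) ∞ N] (hf : IsLegendrian S f) {p : N}
    {u w u' w' : TangentSpace (𝓡 n) p}
    (h : df (n := n) f p u + S.φ (f p) (df (n := n) f p w) =
      df (n := n) f p u' + S.φ (f p) (df (n := n) f p w')) : u = u' ∧ w = w' :=
  KappaMu.eq_of_add_eq_add (D := (df (n := n) f p).toLinearMap)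
    (φ := (S.φ (f p)).toLinearMap) (ξ := S.ξ (f p)) (hf.immersion p) (hf.inner_ξ p) (hf.inner_φ p)
    (fun v ↦ S.φ_φ v) h

theorem IsLegendrian.isSplitting_iff [IsManifold (𝓡 n) ∞ N] (hf : IsLegendrian S f) {p : N}
    {V : TangentSpace (𝓡 (2 * n + 1)) (f p)} {u₀ w₀ : TangentSpace (𝓡 n) p}
    (hV : S.h (f p) V = df (n := n) f p u₀ + S.φ (f p) (df (n := n) f p w₀))
    (u w : TangentSpace (𝓡 n) p) : IsSplitting S f p V u w ↔ u = u₀ ∧ w = w₀ := by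
  constructor
  · intro h
    exact hf.eq_of_add_eq_add (h.1.symm.trans hV)
  · rintro ⟨rfl, rfl⟩
    refine ⟨hV, fun Z ↦ ?_⟩
    rw [real_inner_comm]
    exact hf.inner_φ p Z _

theorem IsLegendrian.exists_parts [IsManifold (𝓡 n) ∞ N] (hf : IsLegendrian S f) {κ μ : ℝ}
    (hS : S.IsKappaMuSpace κ μ) (p : N) :
    ∃ h₁ h₂ : TangentSpace (𝓡 n) p →ₗ[ℝ] TangentSpace (𝓡 n) p,
      (∀ X, S.h (f p) (df (n := n) f p X) =
        df (n := n) f p (h₁ X) + S.φ (f p) (df (n := n) f p (h₂ X))) ∧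
      (∀ X Y, inner ℝ (df (n := n) f p (h₁ X)) (df (n := n) f p Y) =
        inner ℝ (df (n := n) f p X) (df (n := n) f p (h₁ Y))) ∧
      (∀ X Y, inner ℝ (df (n := n) f p (h₂ X)) (df (n := n) f p Y) =
        inner ℝ (df (n := n) f p X) (df (n := n) f p (h₂ Y))) ∧
      h₁ ∘ₗ h₁ + h₂ ∘ₗ h₂ = (1 - κ) • LinearMap.id ∧ h₁ ∘ₗ h₂ = h₂ ∘ₗ h₁ := by
  obtain ⟨cov, hcov, hR⟩ := hS
  have : FiniteDimensional ℝ (TangentSpace (𝓡 n) p) :=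
    inferInstanceAs (FiniteDimensional ℝ (EuclideanSpace ℝ (Fin n)))
  have : FiniteDimensional ℝ (TangentSpace (𝓡 (2 * n + 1)) (f p)) :=
    inferInstanceAs (FiniteDimensional ℝ (EuclideanSpace ℝ (Fin (2 * n + 1))))
  have hP : Module.finrank ℝ (TangentSpace (𝓡 n) p) = n :=
    finrank_euclideanSpace_fin (𝕜 := ℝ) (n := n)
  have hT : Module.finrank ℝ (TangentSpace (𝓡 (2 * n + 1)) (f p)) = 2 * n + 1 :=
    finrank_euclideanSpace_fin (𝕜 := ℝ) (n := 2 * n + 1)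
  exact exists_tangent_normal_parts (D := (df (n := n) f p).toLinearMap)
    (φ := (S.φ (f p)).toLinearMap) (h := (S.h (f p)).toLinearMap) (ξ := S.ξ (f p))
    hP hT (hf.immersion p) (hf.inner_ξ p) (hf.inner_φ p) S.inner_ξ_ξ
    (fun v w ↦ S.inner_φ_right v w) (fun v ↦ S.φ_φ v) S.φ_ξ (fun v w ↦ S.inner_h hcov v w)
    (fun v ↦ S.h_φ hcov v) (S.h_ξ hcov) (fun v ↦ S.h_h hcov hR v)

end Legendrian

end KappaMu

theorem mainTheorem3 {n : ℕ}
    {M : Type*} [TopologicalSpace M] [ChartedSpace (EuclideanSpace ℝ (Fin (2 * n + 1))) M]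
    [IsManifold (𝓡 (2 * n + 1)) ∞ M]
    [RiemannianBundle (fun x : M ↦ TangentSpace (𝓡 (2 * n + 1)) x)]
    [IsContMDiffRiemannianBundle (𝓡 (2 * n + 1)) ∞ (EuclideanSpace ℝ (Fin (2 * n + 1)))
      (fun x : M ↦ TangentSpace (𝓡 (2 * n + 1)) x)]
    {N : Type*} [TopologicalSpace N] [ChartedSpace (EuclideanSpace ℝ (Fin n)) N]
    [IsManifold (𝓡 n) ∞ N]
    (S : KappaMu.ContactMetricStructure (𝓡 (2 * n + 1)) M) (κ μ : ℝ)
    (hS : S.IsKappaMuSpace κ μ)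
    (f : N → M) (hf : KappaMu.IsLegendrian S f) :
    ∃ h₁ h₂ : Π p : N, TangentSpace (𝓡 n) p →ₗ[ℝ] TangentSpace (𝓡 n) p,
      -- `h₁`, `h₂` are the operators of the splitting `h X = h₁ X + φ h₂ X`, and only these
      (∀ (p : N) (X u w : TangentSpace (𝓡 n) p),
        KappaMu.IsSplitting S f p (KappaMu.df f p X) u w ↔ u = h₁ p X ∧ w = h₂ p X) ∧
      -- `h₁ ξ = h₂ ξ = 0`
      (∀ (p : N) (u w : TangentSpace (𝓡 n) p),
        KappaMu.IsSplitting S f p (S.ξ (f p)) u w ↔ u = 0 ∧ w = 0) ∧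
      -- symmetry with respect to the induced metric
      (∀ (p : N) (X Y : TangentSpace (𝓡 n) p),
        inner ℝ (KappaMu.df f p (h₁ p X)) (KappaMu.df f p Y) =
          inner ℝ (KappaMu.df f p X) (KappaMu.df f p (h₁ p Y))) ∧
      (∀ (p : N) (X Y : TangentSpace (𝓡 n) p),
        inner ℝ (KappaMu.df f p (h₂ p X)) (KappaMu.df f p Y) =
          inner ℝ (KappaMu.df f p X) (KappaMu.df f p (h₂ p Y))) ∧
      (∀ p : N, h₁ p ∘ₗ h₁ p + h₂ p ∘ₗ h₂ p = (1 - κ) • LinearMap.id) ∧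
      (∀ p : N, h₁ p ∘ₗ h₂ p = h₂ p ∘ₗ h₁ p) := by
  choose h₁ h₂ hsplit hsymm₁ hsymm₂ hsq hcomm using hf.exists_parts hS
  refine ⟨h₁, h₂, fun p X u w ↦ hf.isSplitting_iff (hsplit p X) u w,
    fun p u w ↦ hf.isSplitting_iff ?_ u w, hsymm₁, hsymm₂, hsq, hcomm⟩
  obtain ⟨cov, hcov, -⟩ := hS
  rw [S.h_ξ hcov, map_zero, map_zero, add_zero]
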